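/- Let $L=\begin{pmatrix}1&0\\1&1\end{pmatrix}$ and $R=\begin{pmatrix}1&1\\0&1\end{pmatrix}$, which freely generate the monoid $\mathrm{SL}_2(\mathbb N)$ of matrices in $\mathrm{SL}_2(\mathbb Z)$ with non-negative entries. For $A\in \mathrm{SL}_2(\mathbb N)$, let $\mathrm{Rad}(A)=\#R-\#L$ be the difference between the numbers of letters $R$ and $L$ in the $\{L,R\}$-factorisation of $A$. Let $A_q$ be the matrix over $\mathbb Z[q^{\pm1}]$ obtained from this factorisation by the substitution of $L_q=\begin{pmatrix}q&0\\1&q^{-1}\end{pmatrix}$ for $L$ and $R_q=\begin{pmatrix}q&1\\0&q^{-1}\end{pmatrix}$ for $R$. Let $B_3=\langle\sigma_1,\sigma_2\mid \sigma_1\sigma_2\sigma_1=\sigma_2\sigma_1\sigma_2\rangle$ be the braid group on three strands, and let $\sigma_A\in B_3$ be the image of $A$ by the morphism of monoids $L\mapsto\sigma_1^{-1}$, $R\mapsto\sigma_2$. Finally, let $U=\mathrm{PSL}_2(\mathbb Z)\backslash \mathrm{PSL}_2(\mathbb R)$ be the unit tangent bundle of the modular orbifold, with the identification $\pi_1(U)=B_3$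 in which $\sigma_1^{-1}$ and $\sigma_2$ are the classes of the loops $s\mapsto \begin{pmatrix}1&0\\s&1\end{pmatrix}$ and $s\mapsto\begin{pmatrix}1&s\\0&1\end{pmatrix}$, $0\le s\le 1$. Suppose that $A\in \mathrm{SL}_2(\mathbb N)$ is hyperbolic, and primitive in $\mathrm{PSL}_2(\mathbb Z)$ (it generates a maximal cyclic subgroup). Then the modular knot of $A$ (the periodic orbit of the geodesic flow in $U$ that lifts the closed geodesic of $A$) is freely homotopic in $U$ to the loop of $\sigma_A$. Moreover, the one-variable Alexander polynomial $\Delta(t)\in\mathbb Z[t^{\pm1}]$ of the link obtained as the closure of $\sigma_A$ (or of any braid word that represents a conjugate of $\sigma_A$ in $B_3$) is given in terms of $q=\sqrt{-t}$, that is $t=-q^2$, by $$\Delta(-q^2)\doteq\frac{q^{\mathrm{Rad}(A)}-\mathrm{Tr}(A_q)+q^{-\mathrm{Rad}(A)}}{q^2-1+q^{-2}},$$ where $\doteq$ denotes equality up to multiplication by a unit $\pm q^{n}$ of $\mathbb Z[q^{\pm1}]$ (the Alexander polynomial itself is defined up to multiplication by a unit $\pm t^n$). -/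

import Mathlib

open scoped MatrixGroups LaurentPolynomial unitInterval

noncomputable section

namespace ModularBraid

/-! ### The monoid `SL₂(ℕ)` and `{L, R}`-words -/

/-- The two letters `L` and `R`. -/
inductive Letter : Type
  | L : Letter
  | R : Letter

/-- The transvections `L = (1 0; 1 1)` and `R = (1 1; 0 1)`. -/
def Letter.toSL : Letter → SL(2, ℤ)
  | .L => ⟨!![1, 0; 1, 1], by simp [Matrix.det_fin_two]⟩
  | .R => ⟨!![1, 1; 0, 1], by simp [Matrix.det_fin_two]⟩

/-- The product in `SL₂(ℤ)` of an `{L, R}`-word. -/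
def wordProd (w : List Letter) : SL(2, ℤ) := (w.map Letter.toSL).prod

/-- `SL₂(ℕ)`: the submonoid of `SL₂(ℤ)` of matrices with non-negative entries. -/
def SL2N : Submonoid SL(2, ℤ) where
  carrier := {A | ∀ i j, 0 ≤ A i j}
  one_mem' := by
    intro i j
    fin_cases i <;> fin_cases j <;> simp
  mul_mem' := by
    intro A B hA hB i j
    rw [Matrix.SpecialLinearGroup.coe_mul, Matrix.mul_apply]
    exact Finset.sum_nonneg fun k _ => mul_nonneg (hA i k) (hB k j)

theorem wordProd_cons (x : Letter) (w : List Letter) :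
    wordProd (x :: w) = x.toSL * wordProd w := by
  rw [wordProd, List.map_cons, List.prod_cons, wordProd]

theorem wordProd_cons_L (w : List Letter) :
    wordProd (Letter.L :: w) 0 0 = wordProd w 0 0 ∧ wordProd (Letter.L :: w) 0 1 = wordProd w 0 1 ∧
    wordProd (Letter.L :: w) 1 0 = wordProd w 0 0 + wordProd w 1 0 ∧
    wordProd (Letter.L :: w) 1 1 = wordProd w 0 1 + wordProd w 1 1 := by
  rw [wordProd_cons, Matrix.SpecialLinearGroup.coe_mul]
  simp [Letter.toSL, Matrix.mul_apply, Fin.sum_univ_two]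

theorem wordProd_cons_R (w : List Letter) :
    wordProd (Letter.R :: w) 0 0 = wordProd w 0 0 + wordProd w 1 0 ∧
    wordProd (Letter.R :: w) 0 1 = wordProd w 0 1 + wordProd w 1 1 ∧
    wordProd (Letter.R :: w) 1 0 = wordProd w 1 0 ∧ wordProd (Letter.R :: w) 1 1 = wordProd w 1 1 := by
  rw [wordProd_cons, Matrix.SpecialLinearGroup.coe_mul]
  simp [Letter.toSL, Matrix.mul_apply, Fin.sum_univ_two]

theorem det_eq (A : SL(2, ℤ)) : A 0 0 * A 1 1 - A 0 1 * A 1 0 = 1 := by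
  have h := A.det_coe
  rwa [Matrix.det_fin_two] at h

theorem ext_entries {A B : SL(2, ℤ)} (h00 : A 0 0 = B 0 0) (h01 : A 0 1 = B 0 1)
    (h10 : A 1 0 = B 1 0) (h11 : A 1 1 = B 1 1) : A = B := by
  ext i j
  fin_cases i <;> fin_cases j <;> assumption

theorem wordProd_nonneg (w : List Letter) : ∀ i j, 0 ≤ wordProd w i j := by
  induction w with
  | nil => exact SL2N.one_mem
  | cons x w ih =>
    have h00 := ih 0 0
    have h01 := ih 0 1
    have h10 := ih 1 0
    have h11 := ih 1 1
    cases x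
    · obtain ⟨a, b, c, d⟩ := wordProd_cons_L w
      intro i j
      fin_cases i <;> fin_cases j <;> simp only [Fin.zero_eta, Fin.mk_one] <;> omega
    · obtain ⟨a, b, c, d⟩ := wordProd_cons_R w
      intro i j
      fin_cases i <;> fin_cases j <;> simp only [Fin.zero_eta, Fin.mk_one] <;> omega

theorem exists_word (n : ℕ) : ∀ A : SL(2, ℤ), A ∈ SL2N →
    A 0 0 + A 0 1 + A 1 0 + A 1 1 ≤ n → ∃ w, wordProd w = A := by
  induction n with
  | zero =>
    intro A hA hn
    have h := det_eq A
    have h00 := hA 0 0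
    have h01 := hA 0 1
    have h10 := hA 1 0
    have h11 := hA 1 1
    push_cast at hn
    have e : A 0 0 = 0 := by omega
    have e' : A 0 1 = 0 := by omega
    rw [e, e'] at h
    simp at h
  | succ n ih =>
    intro A hA hn
    have h := det_eq A
    have h00 := hA 0 0
    have h01 := hA 0 1
    have h10 := hA 1 0
    have h11 := hA 1 1
    push_cast at hn
    by_cases hR : A 1 0 ≤ A 0 0 ∧ A 1 1 ≤ A 0 1
    · let B : SL(2, ℤ) := ⟨!![A 0 0 - A 1 0, A 0 1 - A 1 1; A 1 0, A 1 1], by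
        rw [Matrix.det_fin_two]; simp; linarith⟩
      have b00 : B 0 0 = A 0 0 - A 1 0 := rfl
      have b01 : B 0 1 = A 0 1 - A 1 1 := rfl
      have b10 : B 1 0 = A 1 0 := rfl
      have b11 : B 1 1 = A 1 1 := rfl
      have hpos : 0 < A 1 0 + A 1 1 := by
        by_contra hc
        have e : A 1 0 = 0 := by omega
        have e' : A 1 1 = 0 := by omega
        rw [e, e'] at h
        simp at h
      obtain ⟨w, hw⟩ := ih B
        (by intro i j; fin_cases i <;> fin_cases j <;> simp only [Fin.zero_eta, Fin.mk_one] <;> omega)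
        (by omega)
      obtain ⟨a, b, c, d⟩ := wordProd_cons_R w
      rw [hw] at a b c d
      exact ⟨Letter.R :: w, ext_entries (by omega) (by omega) (by omega) (by omega)⟩
    by_cases hL : A 0 0 ≤ A 1 0 ∧ A 0 1 ≤ A 1 1
    · let B : SL(2, ℤ) := ⟨!![A 0 0, A 0 1; A 1 0 - A 0 0, A 1 1 - A 0 1], by
        rw [Matrix.det_fin_two]; simp; linarith⟩
      have b00 : B 0 0 = A 0 0 := rfl
      have b01 : B 0 1 = A 0 1 := rfl
      have b10 : B 1 0 = A 1 0 - A 0 0 := rfl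
      have b11 : B 1 1 = A 1 1 - A 0 1 := rfl
      have hpos : 0 < A 0 0 + A 0 1 := by
        by_contra hc
        have e : A 0 0 = 0 := by omega
        have e' : A 0 1 = 0 := by omega
        rw [e, e'] at h
        simp at h
      obtain ⟨w, hw⟩ := ih B
        (by intro i j; fin_cases i <;> fin_cases j <;> simp only [Fin.zero_eta, Fin.mk_one] <;> omega)
        (by omega)
      obtain ⟨a, b, c, d⟩ := wordProd_cons_L w
      rw [hw] at a b c d
      exact ⟨Letter.L :: w, ext_entries (by omega) (by omega) (by omega) (by omega)⟩
    · refine ⟨[], ?_⟩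
      have key : A 0 1 = 0 ∧ A 1 0 = 0 := by
        rcases lt_or_ge (A 0 0) (A 1 0) with h1 | h1
        · have h2 : A 1 1 < A 0 1 := by
            by_contra hc
            exact hL ⟨h1.le, not_lt.mp hc⟩
          nlinarith [mul_nonneg h00 h11]
        · have h2 : A 0 1 < A 1 1 := by
            by_contra hc
            exact hR ⟨h1, not_lt.mp hc⟩
          have h3 : A 1 0 < A 0 0 := by
            by_contra hc
            exact hL ⟨not_lt.mp hc, h2.le⟩
          constructor <;> nlinarith [mul_nonneg (sub_nonneg.mpr (Int.add_one_le_iff.mpr h2))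
            (sub_nonneg.mpr (Int.add_one_le_iff.mpr h3))]
      rw [key.1, key.2] at h
      have hu : A 0 0 = 1 ∧ A 1 1 = 1 := by
        have h' : A 0 0 * A 1 1 = 1 := by linarith
        rcases Int.mul_eq_one_iff_eq_one_or_neg_one.mp h' with h' | h'
        · exact h'
        · omega
      refine ext_entries ?_ ?_ ?_ ?_ <;> simp [wordProd, key.1, key.2, hu.1, hu.2]

theorem wordProd_injective : Function.Injective wordProd := by
  intro v
  induction v with
  | nil =>
    intro w h
    cases w with
    | nil => rfl
    | cons y w =>
      exfalso
      have n00 := wordProd_nonneg w 0 0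
      have n01 := wordProd_nonneg w 0 1
      have n10 := wordProd_nonneg w 1 0
      have n11 := wordProd_nonneg w 1 1
      have e00 : wordProd [] 0 0 = 1 := by simp [wordProd]
      have e01 : wordProd [] 0 1 = 0 := by simp [wordProd]
      have e10 : wordProd [] 1 0 = 0 := by simp [wordProd]
      have e11 : wordProd [] 1 1 = 1 := by simp [wordProd]
      rw [h] at e00 e01 e10 e11
      cases y
      · obtain ⟨a, b, c, d⟩ := wordProd_cons_L w
        omega
      · obtain ⟨a, b, c, d⟩ := wordProd_cons_R w
        omega
  | cons x v ih =>
    intro w h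
    have m00 := wordProd_nonneg v 0 0
    have m01 := wordProd_nonneg v 0 1
    have m10 := wordProd_nonneg v 1 0
    have m11 := wordProd_nonneg v 1 1
    cases w with
    | nil =>
      exfalso
      have e00 : wordProd [] 0 0 = 1 := by simp [wordProd]
      have e01 : wordProd [] 0 1 = 0 := by simp [wordProd]
      have e10 : wordProd [] 1 0 = 0 := by simp [wordProd]
      have e11 : wordProd [] 1 1 = 1 := by simp [wordProd]
      rw [← h] at e00 e01 e10 e11
      cases x
      · obtain ⟨a, b, c, d⟩ := wordProd_cons_L v
        omega
      · obtain ⟨a, b, c, d⟩ := wordProd_cons_R v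
        omega
    | cons y w =>
      have n00 := wordProd_nonneg w 0 0
      have n01 := wordProd_nonneg w 0 1
      have n10 := wordProd_nonneg w 1 0
      have n11 := wordProd_nonneg w 1 1
      have hd := det_eq (wordProd v)
      cases x <;> cases y
      · rw [ih (a₂ := w) (by
          rw [wordProd_cons, wordProd_cons] at h
          exact mul_left_cancel h)]
      · exfalso
        obtain ⟨a, b, c, d⟩ := wordProd_cons_L v
        obtain ⟨a', b', c', d'⟩ := wordProd_cons_R w
        rw [h] at a b c d
        have e : wordProd v 1 0 = 0 := by omega
        have e' : wordProd v 1 1 = 0 := by omega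
        rw [e, e'] at hd
        simp at hd
      · exfalso
        obtain ⟨a, b, c, d⟩ := wordProd_cons_R v
        obtain ⟨a', b', c', d'⟩ := wordProd_cons_L w
        rw [h] at a b c d
        have e : wordProd v 0 0 = 0 := by omega
        have e' : wordProd v 0 1 = 0 := by omega
        rw [e, e'] at hd
        simp at hd
      · rw [ih (a₂ := w) (by
          rw [wordProd_cons, wordProd_cons] at h
          exact mul_left_cancel h)]

/-- `SL₂(ℕ)` is freely generated by `L` and `R`. -/
theorem existsUnique_word (A : SL2N) : ∃! w, wordProd w = A := by
  obtain ⟨w, hw⟩ := exists_word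
    (A.1 0 0 + A.1 0 1 + A.1 1 0 + A.1 1 1).toNat A.1 A.2 (Int.self_le_toNat _)
  exact ⟨w, hw, fun v hv => wordProd_injective (hv.trans hw.symm)⟩

/-- The unique `{L, R}`-word whose product is `A ∈ SL₂(ℕ)`. -/
def word (A : SL2N) : List Letter := (existsUnique_word A).choose

/-- The exponent `+1` of `R`, and `-1` of `L`. -/
def Letter.sign : Letter → ℤ
  | .L => -1
  | .R => 1

/-- The Rademacher number `Rad(A) = #R - #L`. -/
def Rad (A : SL2N) : ℤ := ((word A).map Letter.sign).sum

/-- The deformed generators `L_q = (q 0; 1 q⁻¹)` and `R_q = (q 1; 0 q⁻¹)` over `ℤ[q, q⁻¹]`;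
here the Laurent variable `T` is `q`. -/
def Letter.deformed : Letter → Matrix (Fin 2) (Fin 2) ℤ[T;T⁻¹]
  | .L => !![LaurentPolynomial.T 1, 0; 1, LaurentPolynomial.T (-1)]
  | .R => !![LaurentPolynomial.T 1, 1; 0, LaurentPolynomial.T (-1)]

/-- The matrix `A_q`. -/
def deform (A : SL2N) : Matrix (Fin 2) (Fin 2) ℤ[T;T⁻¹] :=
  ((word A).map Letter.deformed).prod

/-- An element of a group is primitive when it generates a maximal cyclic subgroup. -/
def IsPrimitiveElement {G : Type*} [Group G] (g : G) : Prop :=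
  ∀ h : G, Subgroup.zpowers g ≤ Subgroup.zpowers h → Subgroup.zpowers h = Subgroup.zpowers g

/-! ### The braid group on three strands -/

/-- The braid relation `σ₁σ₂σ₁ = σ₂σ₁σ₂`; the generator `σ₁` has index `0`, and `σ₂` index `1`. -/
def braidRels : Set (FreeGroup (Fin 2)) :=
  {FreeGroup.of 0 * FreeGroup.of 1 * FreeGroup.of 0 *
    (FreeGroup.of 1 * FreeGroup.of 0 * FreeGroup.of 1)⁻¹}

/-- The braid group `B₃`. -/
abbrev B₃ : Type := PresentedGroup braidRels

/-- Words in `σ₁^{±1}, σ₂^{±1}`; the pair `(i, true)` stands for the generator of index `i`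
and `(i, false)` for its inverse. -/
abbrev BraidWord : Type := List (Fin 2 × Bool)

/-- The braid represented by a braid word. -/
def BraidWord.toBraid (w : BraidWord) : B₃ := PresentedGroup.mk braidRels (FreeGroup.mk w)

/-- `L ↦ σ₁⁻¹` and `R ↦ σ₂`. -/
def Letter.toBraidLetter : Letter → Fin 2 × Bool
  | .L => (0, false)
  | .R => (1, true)

/-- The word of the braid `σ_A`. -/
def sigmaWord (A : SL2N) : BraidWord := (word A).map Letter.toBraidLetter

/-- The braid `σ_A`: the image of `A` by the monoid morphism `(L, R) ↦ (σ₁⁻¹, σ₂)`. -/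
def sigma (A : SL2N) : B₃ := BraidWord.toBraid (sigmaWord A)

/-! ### The unit tangent bundle of the modular orbifold and modular knots -/

/-- The image of `SL₂(ℤ)` in `SL₂(ℝ)`. -/
def modularSubgroup : Subgroup SL(2, ℝ) :=
  (Matrix.SpecialLinearGroup.map (n := Fin 2) (Int.castRingHom ℝ)).range

/-- The space `SL₂(ℤ)\SL₂(ℝ) = PSL₂(ℤ)\PSL₂(ℝ)` of cosets `SL₂(ℤ)g` with the quotient topology:
the unit tangent bundle of the modular orbifold. -/
abbrev UnitTangent : Type := Quotient (QuotientGroup.rightRel modularSubgroup)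

/-- The projection `g ↦ SL₂(ℤ)g`. -/
def proj (g : SL(2, ℝ)) : UnitTangent := Quotient.mk _ g

theorem continuous_proj : Continuous proj := continuous_quotient_mk'

/-- The base point of the unit tangent bundle. -/
def base : UnitTangent := proj 1

/-- Cosets do not change under left multiplication by an element of `SL₂(ℤ)`. -/
theorem proj_mul (A : SL(2, ℤ)) (g : SL(2, ℝ)) :
    proj (Matrix.SpecialLinearGroup.map (Int.castRingHom ℝ) A * g) = proj g := by
  apply Quotient.sound
  change QuotientGroup.rightRel modularSubgroup _ _
  rw [QuotientGroup.rightRel_apply]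
  simp only [mul_inv_rev, mul_inv_cancel_left]
  exact inv_mem ⟨A, rfl⟩

/-- The unipotent matrices `L^s = (1 0; s 1)` and `R^s = (1 s; 0 1)`. -/
def Letter.unipotent : Letter → ℝ → SL(2, ℝ)
  | .L, s => ⟨!![1, 0; s, 1], by simp [Matrix.det_fin_two]⟩
  | .R, s => ⟨!![1, s; 0, 1], by simp [Matrix.det_fin_two]⟩

theorem Letter.continuous_unipotent (x : Letter) : Continuous x.unipotent := by
  cases x <;>
  · refine Continuous.subtype_mk (continuous_matrix ?_) _
    intro i j
    fin_cases i <;> fin_cases j <;> simp <;> fun_prop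

/-- The loop `s ↦ SL₂(ℤ)·x^s`, for `x = L` or `R` and `0 ≤ s ≤ 1`. -/
def Letter.loop (x : Letter) : Path base base where
  toFun s := proj (x.unipotent s)
  continuous_toFun :=
    continuous_proj.comp (x.continuous_unipotent.comp continuous_subtype_val)
  source' := by
    have h : x.unipotent 0 = 1 := by
      cases x <;> ext i j <;> fin_cases i <;> fin_cases j <;> simp [Letter.unipotent]
    simp [h, base]
  target' := by
    have h : x.unipotent 1 =
        Matrix.SpecialLinearGroup.map (Int.castRingHom ℝ) x.toSL * 1 := by
      rw [mul_one]
      ext i j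
      rw [Matrix.SpecialLinearGroup.map_apply_coe]
      cases x <;> fin_cases i <;> fin_cases j <;> simp [Letter.unipotent, Letter.toSL]
    simp only [Set.Icc.coe_one, h, base, proj_mul]

/-- The loops of `σ₁^{±1}` and `σ₂^{±1}`: those of `σ₁⁻¹` and `σ₂` are the loops of `L` and `R`. -/
def genLoop : Fin 2 × Bool → Path base base
  | (0, true) => Letter.L.loop.symm
  | (0, false) => Letter.L.loop
  | (1, true) => Letter.R.loop
  | (1, false) => Letter.R.loop.symm

/-- The loop of a braid word under the identification of `B₃` with the fundamental group of the
unit tangent bundle: the concatenation of the loops of its letters. -/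
def braidLoop : BraidWord → Path base base
  | [] => Path.refl base
  | x :: w => (genLoop x).trans (braidLoop w)

/-- Free homotopy of loops. -/
def FreelyHomotopic {X : Type*} [TopologicalSpace X] (γ₀ γ₁ : C(I, X)) : Prop :=
  ContinuousMap.HomotopicWith γ₀ γ₁ fun γ => γ 0 = γ 1

/-- The matrix `diag(e^s, e^{-s})`; right multiplication by it is the geodesic flow
at time `2s`. -/
def flow (s : ℝ) : SL(2, ℝ) :=
  ⟨!![Real.exp s, 0; 0, Real.exp (-s)], by simp [Matrix.det_fin_two, ← Real.exp_add]⟩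

/-- `γ` is the modular knot of a hyperbolic `A` of positive trace, parametrised proportionally to
arc length: the orbit of the geodesic flow through a unit vector `g` of the axis of `A`, pointing
to the attractive fixed point, from `g` to `A g`. -/
def IsModularKnot (A : SL(2, ℤ)) (γ : C(I, UnitTangent)) : Prop :=
  ∃ (g : SL(2, ℝ)) (l : ℝ), 0 < l ∧
    Matrix.SpecialLinearGroup.map (Int.castRingHom ℝ) A * g = g * flow l ∧
    ∀ s : I, γ s = proj (g * flow (s * l))

/-! ### Alexander polynomials of oriented link diagrams -/

/-- A vertex of an oriented link diagram that is cut into oriented segments (with set `S`): either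
a point where the segment `a` is continued by the segment `b`, or a crossing (positive if `pos` is
true, and negative otherwise), where `overIn` is continued by `overOut` on the upper strand, and
`underIn` by `underOut` on the lower strand. -/
inductive Vertex (S : Type) : Type
  | joint (a b : S) : Vertex S
  | crossing (pos : Bool) (overIn overOut underIn underOut : S) : Vertex S

/-- The incidence data of an oriented link diagram: the finite set of its segments and its
vertices. -/
structure Diagram : Type 1 where
  Seg : Type
  [fintype : Fintype Seg]
  [decEq : DecidableEq Seg]
  vertices : Set (Vertex Seg)

attribute [instance] Diagram.fintype Diagram.decEq

/-- The variable `t` at a positive crossing, and `t⁻¹` at a negative crossing. -/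
def crossingVar (pos : Bool) : ℤ[T;T⁻¹] := LaurentPolynomial.T (if pos then 1 else -1)

/-- The rows of the Alexander matrix at a vertex: the abelianised Fox derivatives of the Wirtinger
relations, every meridian being sent to `t`. At a joint the relation is `b = a`. At a crossing the
relations are `overOut = overIn` and `underOut = o^ε underIn o^{-ε}` with `o = overIn` and `ε` the
sign of the crossing. -/
def Vertex.rows {S : Type} [DecidableEq S] : Vertex S → Set (S → ℤ[T;T⁻¹])
  | .joint a b => {Pi.single a 1 - Pi.single b 1}
  | .crossing pos overIn overOut underIn underOut =>
    {Pi.single overIn 1 - Pi.single overOut 1,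
      crossingVar pos • Pi.single underIn 1 + (1 - crossingVar pos) • Pi.single overIn 1 -
        Pi.single underOut 1}

/-- The rows of the Alexander matrix of a diagram; its columns are indexed by the segments. -/
def Diagram.rows (D : Diagram) : Set (D.Seg → ℤ[T;T⁻¹]) := ⋃ v ∈ D.vertices, v.rows

/-- The Alexander ideal (first elementary ideal): with `n` columns, it is generated by the minors
of size `n - 1` of the Alexander matrix. -/
def Diagram.alexanderIdeal (D : Diagram) : Ideal ℤ[T;T⁻¹] :=
  Ideal.span {d | ∃ (r : Fin (Fintype.card D.Seg - 1) → D.Seg → ℤ[T;T⁻¹])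
    (c : Fin (Fintype.card D.Seg - 1) → D.Seg),
    (∀ i, r i ∈ D.rows) ∧ d = (Matrix.of fun i j => r i (c j)).det}

/-- `P ∈ ℤ[t, t⁻¹]` is the (one-variable) Alexander polynomial of the link with diagram `D`: it
generates the smallest principal ideal that contains the Alexander ideal. It is defined up to a
unit. -/
def Diagram.IsAlexanderPolynomial (D : Diagram) (P : ℤ[T;T⁻¹]) : Prop :=
  D.alexanderIdeal ≤ Ideal.span {P} ∧
    ∀ Q : ℤ[T;T⁻¹], D.alexanderIdeal ≤ Ideal.span {Q} → Q ∣ P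

/-- The vertices between the heights `a` and `b` of a three-strand braid, for one letter. The strands
run upwards, the segment of the strand in position `i` at height `a` is `(a, i)`. The generator of
index `i` is the positive crossing of the positions `i` and `i + 1` in which the strand that goes
from `i` to `i + 1` is the upper one; its inverse is the negative crossing in which the strand that
goes from `i + 1` to `i` is the upper one. The third strand, in position `k`, goes straight up. -/
def braidLetterVertices {H : Type} (a b : H) : Fin 2 × Bool → Set (Vertex (H × Fin 3))
  | (i, true) => {Vertex.crossing true (a, i.castSucc) (b, i.succ) (a, i.succ) (b, i.castSucc)} ∪
      {v | ∃ k, k ≠ i.castSucc ∧ k ≠ i.succ ∧ v = Vertex.joint (a, k) (b, k)}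
  | (i, false) => {Vertex.crossing false (a, i.succ) (b, i.castSucc) (a, i.castSucc) (b, i.succ)} ∪
      {v | ∃ k, k ≠ i.castSucc ∧ k ≠ i.succ ∧ v = Vertex.joint (a, k) (b, k)}

/-- The diagram of the closure of the braid word `w`: its segments lie at the heights
`0, …, length w`, and the segments at the top are continued by those at the bottom. -/
def closure (w : BraidWord) : Diagram where
  Seg := Fin (w.length + 1) × Fin 3
  vertices :=
    (⋃ k : Fin w.length, braidLetterVertices k.castSucc k.succ (w.get k)) ∪
      Set.range fun i : Fin 3 => Vertex.joint (Fin.last w.length, i) (0, i)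

/-- The unit `-q²` of `ℤ[q, q⁻¹]`. -/
def negSq : (ℤ[T;T⁻¹])ˣ where
  val := -LaurentPolynomial.T 2
  inv := -LaurentPolynomial.T (-2)
  val_inv := by rw [neg_mul_neg, ← LaurentPolynomial.T_add]; simp
  inv_val := by rw [neg_mul_neg, ← LaurentPolynomial.T_add]; simp

/-- The substitution `t = -q²`, from `ℤ[t, t⁻¹]` to `ℤ[q, q⁻¹]`. -/
def substNegSq : ℤ[T;T⁻¹] →+* ℤ[T;T⁻¹] :=
  LaurentPolynomial.eval₂ (algebraMap ℤ ℤ[T;T⁻¹]) negSq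

end ModularBraid

end

/-!
The rows of the Alexander matrix at the letters of a braid word express each level of three
segments by the previous one, through the Burau matrix of the letter. Eliminating the levels
leaves `B - 1`, where `B` is the Burau matrix of the braid, so the first minors of the two matrices
agree up to sign. As `B - 1` has rank at most `2`, with kernels spanned by vectors with an entry
`1`, its adjugate is a scalar multiple of a fixed matrix of rank one. That scalar generates the
Alexander ideal, and taking traces identifies it, times `1 + t + t²`, with `det B - Tr B + 2`. Both
`det B` and `Tr B` are conjugation invariants, and for `t = -q²` they can be computed on `σ_A`
itself: on the invariant plane of vectors with coordinates of sum `0` the letters act by `q^{±1}`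
times the matrices `L_q` and `R_q`, so `det B = q^{2 Rad A}` and `Tr B = 1 + q^{Rad A} Tr A_q`.

For the homotopy, lift the loop of the positive word `σ_A` to a path from `1` to `A` in `SL₂(ℝ)`.
The modular knot through the coset of `g` lifts, up to right translation by `g`, to the path
`s ↦ g · flow (s l) · g⁻¹` with the same end points. Both paths stay among the matrices with
positive first entry, which form a contractible set, so they are homotopic; a path from `1` to `g`
then absorbs the translation.
-/

noncomputable section

namespace ModularBraid

open Matrix
open LaurentPolynomial (T)

/-! ### Minors and adjugates -/

section Adjugate

variable {R : Type*} [CommRing R]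

theorem exists_eq_succAbove_comp_perm {m : ℕ} {f : Fin m → Fin (m + 1)}
    (hf : Function.Injective f) :
    ∃ (j : Fin (m + 1)) (e : Equiv.Perm (Fin m)), f = j.succAbove ∘ e := by
  have not_surjective : ¬Function.Surjective f := fun hs => by
    simpa using Fintype.card_le_of_surjective f hs
  obtain ⟨j, hj⟩ := not_forall.mp not_surjective
  choose g hg using fun i => Fin.exists_succAbove_eq fun h : f i = j => hj ⟨i, h⟩
  have g_injective : Function.Injective g := fun a b hab => hf (by rw [← hg a, ← hg b, hab])
  exact ⟨j, Equiv.ofBijective g (Finite.injective_iff_bijective.mp g_injective),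
    funext fun i => (hg i).symm⟩

theorem det_submatrix_mem_span_adjugate {m : ℕ} (A : Matrix (Fin (m + 1)) (Fin (m + 1)) R)
    (f c : Fin m → Fin (m + 1)) :
    (A.submatrix f c).det ∈ Ideal.span (Set.range fun p : Fin (m + 1) × Fin (m + 1) =>
      A.adjugate p.1 p.2) := by
  by_cases hf : Function.Injective f
  · by_cases hc : Function.Injective c
    · obtain ⟨j, e, rfl⟩ := exists_eq_succAbove_comp_perm hf
      obtain ⟨i, e', rfl⟩ := exists_eq_succAbove_comp_perm hc
      have minor_eq : (A.submatrix j.succAbove i.succAbove).det =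
          (-1) ^ (j + i : ℕ) * A.adjugate i j := by
        rw [A.adjugate_fin_succ_eq_det_submatrix i j, ← mul_assoc, ← mul_pow]
        simp
      have permuted : A.submatrix (j.succAbove ∘ e) (i.succAbove ∘ e') =
          ((A.submatrix j.succAbove i.succAbove).submatrix id e').submatrix e id := rfl
      rw [permuted, det_permute, det_permute', minor_eq]
      exact Ideal.mul_mem_left _ _ (Ideal.mul_mem_left _ _ (Ideal.mul_mem_left _ _
        (Ideal.subset_span ⟨(i, j), rfl⟩)))
    · obtain ⟨a, b, hab, hne⟩ := Function.not_injective_iff.mp hc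
      rw [det_zero_of_column_eq hne fun k => by simp [hab]]
      exact zero_mem _
  · obtain ⟨a, b, hab, hne⟩ := Function.not_injective_iff.mp hf
    rw [det_zero_of_row_eq hne (by funext k; simp [hab])]
    exact zero_mem _

variable {S : Type*} [Fintype S] [DecidableEq S]

theorem span_minors_eq_span_adjugate [Nonempty S] (A : Matrix S S R) :
    Ideal.span {d | ∃ (r : Fin (Fintype.card S - 1) → S → R) (c : Fin (Fintype.card S - 1) → S),
      (∀ i, r i ∈ Set.range A.row) ∧ d = (of fun i j => r i (c j)).det} =
    Ideal.span (Set.range fun p : S × S => A.adjugate p.1 p.2) := by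
  have e : S ≃ Fin (Fintype.card S - 1 + 1) :=
    Fintype.equivFinOfCardEq (Nat.sub_add_cancel Fintype.card_pos).symm
  generalize Fintype.card S - 1 = m at e
  set B := A.submatrix e.symm e.symm with hB
  have adjugate_B : ∀ i j, B.adjugate i j = A.adjugate (e.symm i) (e.symm j) := fun i j => by
    rw [hB, adjugate_submatrix_equiv_self, submatrix_apply]
  apply le_antisymm <;> refine Ideal.span_le.mpr ?_
  · rintro d ⟨r, c, hr, rfl⟩
    choose f hf using hr
    have minor_eq : (of fun i j => r i (c j)) = B.submatrix (e ∘ f) (e ∘ c) := by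
      ext i j
      simp [hB, ← hf]
    rw [SetLike.mem_coe, minor_eq]
    refine Ideal.span_mono ?_ (det_submatrix_mem_span_adjugate B (e ∘ f) (e ∘ c))
    rintro _ ⟨p, rfl⟩
    exact ⟨(e.symm p.1, e.symm p.2), (adjugate_B _ _).symm⟩
  · rintro _ ⟨⟨i, j⟩, rfl⟩
    have h := adjugate_B (e i) (e j)
    rw [e.symm_apply_apply, e.symm_apply_apply, B.adjugate_fin_succ_eq_det_submatrix] at h
    change A.adjugate i j ∈ _
    rw [← h]
    refine Ideal.mul_mem_left _ _ (Ideal.subset_span ?_)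
    exact ⟨fun k => A.row (e.symm ((e j).succAbove k)),
      fun k => e.symm ((e i).succAbove k), fun k => ⟨_, rfl⟩, rfl⟩

theorem adjugate_apply_of_mulVec_eq_zero {A : Matrix S S R} {v : S → R} {i : S}
    (hv : A *ᵥ v = 0) (hi : v i = 1) (a j : S) : A.adjugate a j = v a * A.adjugate i j := by
  set N := A.updateRow j (Pi.single a 1 + (-v a) • Pi.single i 1) with N_def
  have hN : N *ᵥ v = 0 := by
    rw [N_def, updateRow_mulVec, hv]
    simp [add_dotProduct, smul_dotProduct, hi]
  have hdet : N.det = 0 :=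
    det_eq_zero_of_mulVec_eq_zero_of_mem_nonZeroDivisors hN (hi ▸ one_mem _)
  rw [N_def, det_updateRow_add, det_updateRow_smul, ← adjugate_apply, ← adjugate_apply] at hdet
  linear_combination hdet

theorem adjugate_apply_of_vecMul_eq_zero {A : Matrix S S R} {u : S → R} {j : S}
    (hu : u ᵥ* A = 0) (hj : u j = 1) (i b : S) : A.adjugate i b = u b * A.adjugate i j := by
  have h := adjugate_apply_of_mulVec_eq_zero (A := Aᵀ) (by rwa [mulVec_transpose]) hj b i
  rwa [← adjugate_transpose, transpose_apply, transpose_apply] at h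

theorem adjugate_apply_of_kernels {A : Matrix S S R} {u v : S → R} {i j : S}
    (hv : A *ᵥ v = 0) (hi : v i = 1) (hu : u ᵥ* A = 0) (hj : u j = 1) (a b : S) :
    A.adjugate a b = v a * u b * A.adjugate i j := by
  rw [adjugate_apply_of_mulVec_eq_zero hv hi, adjugate_apply_of_vecMul_eq_zero hu hj, mul_assoc]

theorem span_adjugate_eq_span_singleton {A : Matrix S S R} {u v : S → R} {i j : S}
    (hv : A *ᵥ v = 0) (hi : v i = 1) (hu : u ᵥ* A = 0) (hj : u j = 1) :
    Ideal.span (Set.range fun p : S × S => A.adjugate p.1 p.2) = Ideal.span {A.adjugate i j} := by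
  apply le_antisymm
  · refine Ideal.span_le.mpr ?_
    rintro _ ⟨⟨a, b⟩, rfl⟩
    exact Ideal.mem_span_singleton'.mpr ⟨v a * u b,
      (adjugate_apply_of_kernels hv hi hu hj a b).symm⟩
  · exact Ideal.span_mono (Set.singleton_subset_iff.mpr ⟨(i, j), rfl⟩)

theorem trace_adjugate_of_kernels {A : Matrix S S R} {u v : S → R} {i j : S}
    (hv : A *ᵥ v = 0) (hi : v i = 1) (hu : u ᵥ* A = 0) (hj : u j = 1) :
    A.adjugate.trace = A.adjugate i j * v ⬝ᵥ u := by
  rw [trace, dotProduct, Finset.mul_sum]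
  exact Finset.sum_congr rfl fun k _ => by
    rw [diag_apply, adjugate_apply_of_kernels hv hi hu hj, mul_comm]

theorem trace_adjugate_sub_one_add_det (B : Matrix (Fin 3) (Fin 3) R) :
    (B - 1).adjugate.trace + (B - 1).det = B.det - B.trace + 2 := by
  rw [adjugate_fin_three, det_fin_three, det_fin_three, trace_fin_three, trace_fin_three]
  simp only [Matrix.sub_apply, one_apply, Fin.reduceEq, if_true, if_false, of_apply, cons_val]
  ring

end Adjugate

/-! ### Cyclic block matrices -/

section CyclicBlock

variable {R : Type*} [CommRing R] {ι : Type*} [DecidableEq ι] {n : ℕ}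

/-- The matrix of the relations `x_{k+1} = S k · x_k` for `k < n` and `P · x_n + Q · x_0 = 0`
between `n + 1` vectors: the latter is the block row of index `0`, and the relation for `x_{k+1}`
is the block row of index `k + 1`. -/
def cyclicBlock (S : Fin n → Matrix ι ι R) (P Q : Matrix ι ι R) :
    Matrix (Fin (n + 1) × ι) (Fin (n + 1) × ι) R :=
  of fun x y => Fin.cases
    ((if y.1 = Fin.last n then P x.2 y.2 else 0) + if y.1 = 0 then Q x.2 y.2 else 0)
    (fun k => (if y.1 = k.castSucc then S k x.2 y.2 else 0) -
      if y.1 = k.succ then (1 : Matrix ι ι R) x.2 y.2 else 0) x.1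

variable (S : Fin n → Matrix ι ι R) (P Q : Matrix ι ι R)

theorem cyclicBlock_zero (i : ι) (y : Fin (n + 1) × ι) : cyclicBlock S P Q (0, i) y =
    (if y.1 = Fin.last n then P i y.2 else 0) + if y.1 = 0 then Q i y.2 else 0 := rfl

theorem cyclicBlock_succ (k : Fin n) (i : ι) (y : Fin (n + 1) × ι) :
    cyclicBlock S P Q (k.succ, i) y = (if y.1 = k.castSucc then S k i y.2 else 0) -
      if y.1 = k.succ then (1 : Matrix ι ι R) i y.2 else 0 := rfl

theorem cyclicBlock_updateRow (i j : ι) :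
    (cyclicBlock S P Q).updateRow (0, i) (Pi.single (0, j) 1) =
      cyclicBlock S (P.updateRow i 0) (Q.updateRow i (Pi.single j 1)) := by
  ext ⟨h, a⟩ ⟨h', b⟩
  refine Fin.cases ?_ (fun k => ?_) h
  · rw [cyclicBlock_zero]
    by_cases hai : a = i
    · subst hai
      simp [Pi.single_apply, Prod.ext_iff, ite_and]
    · rw [updateRow_ne (by simpa using hai), cyclicBlock_zero, updateRow_ne hai, updateRow_ne hai]
  · rw [updateRow_ne (by simp), cyclicBlock_succ, cyclicBlock_succ]

/-- The bijection that singles out the last of `n + 1` blocks of indices. -/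
def lastBlockEquiv (ι : Type*) (n : ℕ) : Fin (n + 1) × ι ≃ ι ⊕ Fin n × ι :=
  (finSuccEquivLast.prodCongr (Equiv.refl ι)).trans optionProdEquiv

theorem cyclicBlock_submatrix_lastBlockEquiv (S : Fin (n + 1) → Matrix ι ι R) :
    (cyclicBlock S P Q).submatrix (lastBlockEquiv ι (n + 1)).symm (lastBlockEquiv ι (n + 1)).symm =
      fromBlocks (-1) (of fun i y => if y.1 = Fin.last n then S (Fin.last n) i y.2 else 0)
        (of fun x j => if x.1 = 0 then P x.2 j else 0) (cyclicBlock (Fin.init S) 0 Q) := by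
  have inl_eq : ∀ i, (lastBlockEquiv ι (n + 1)).symm (Sum.inl i) = ((Fin.last n).succ, i) :=
    fun i => rfl
  have inr_eq : ∀ h i, (lastBlockEquiv ι (n + 1)).symm (Sum.inr (h, i)) = (h.castSucc, i) :=
    fun h i => by simp [lastBlockEquiv]
  ext (i | ⟨h, i⟩) (j | ⟨h', j⟩)
  · rw [submatrix_apply, inl_eq, inl_eq, cyclicBlock_succ, fromBlocks_apply₁₁]
    simp [Fin.ext_iff]
  · rw [submatrix_apply, inl_eq, inr_eq, cyclicBlock_succ]
    simp [(Fin.castSucc_lt_last h').ne]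
  · rw [submatrix_apply, inl_eq, inr_eq, fromBlocks_apply₂₁]
    refine Fin.cases ?_ (fun k => ?_) h
    · simp [cyclicBlock_zero]
    · rw [← Fin.succ_castSucc, cyclicBlock_succ]
      simp [← Fin.castSucc_succ, (Fin.castSucc_lt_last _).ne']
  · rw [submatrix_apply, inr_eq, inr_eq, fromBlocks_apply₂₂]
    refine Fin.cases ?_ (fun k => ?_) h
    · simp [cyclicBlock_zero, (Fin.castSucc_lt_last h').ne]
    · rw [← Fin.succ_castSucc, cyclicBlock_succ]
      simp [cyclicBlock_succ, Fin.init, Fin.ext_iff]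

variable [Fintype ι]

theorem cyclicBlock_one_neg_one_mulVec {v : ι → R} (hv : ∀ k, S k *ᵥ v = v) :
    cyclicBlock S 1 (-1) *ᵥ (fun x => v x.2) = 0 := by
  ext ⟨h, i⟩
  refine Fin.cases ?_ (fun k => ?_) h
  · simp [mulVec, dotProduct, Fintype.sum_prod_type, cyclicBlock_zero, add_mul, ite_mul,
      Finset.sum_add_distrib, one_apply]
  · have hk := congrFun (hv k) i
    simp only [mulVec, dotProduct] at hk
    simp [mulVec, dotProduct, Fintype.sum_prod_type, cyclicBlock_succ, sub_mul, ite_mul,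
      Finset.sum_sub_distrib, one_apply, hk]

theorem vecMul_cyclicBlock_one_neg_one {u : ι → R} (hu : ∀ k, u ᵥ* S k = u) :
    (fun x => u x.2) ᵥ* cyclicBlock S 1 (-1) = 0 := by
  ext ⟨h, j⟩
  have hk : ∀ k, ∑ i, u i * S k i j = u j := fun k => congrFun (hu k) j
  have castSucc_or_last : (∑ k : Fin n, if h = k.castSucc then u j else 0) +
      (if h = Fin.last n then u j else 0) = u j := by
    rw [← Fin.sum_univ_castSucc fun k => if h = k then u j else 0]
    simp
  have zero_or_succ : (if h = 0 then u j else 0) +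
      (∑ k : Fin n, if h = k.succ then u j else 0) = u j := by
    rw [← Fin.sum_univ_succ fun k => if h = k then u j else 0]
    simp
  have column_sum : ((fun x => u x.2) ᵥ* cyclicBlock S 1 (-1)) (h, j) =
      (if h = Fin.last n then u j else 0) + -(if h = 0 then u j else 0) +
        ((∑ k : Fin n, if h = k.castSucc then u j else 0) -
          ∑ k : Fin n, if h = k.succ then u j else 0) := by
    simp [vecMul, dotProduct, Fintype.sum_prod_type, Fin.sum_univ_succ, cyclicBlock_zero,
      cyclicBlock_succ, mul_add, mul_sub, Finset.sum_add_distrib, Finset.sum_sub_distrib,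
      one_apply, hk, neg_ite]
  rw [column_sum, Pi.zero_apply]
  linear_combination castSucc_or_last - zero_or_succ

theorem det_fromBlocks_neg_one₁₁ {κ : Type*} [Fintype κ] [DecidableEq κ] (B : Matrix ι κ R)
    (C : Matrix κ ι R) (D : Matrix κ κ R) :
    (fromBlocks (-1) B C D).det = (-1) ^ Fintype.card ι * (D + C * B).det := by
  let : Invertible (1 : Matrix ι ι R) := invertibleOne
  let : Invertible (-1 : Matrix ι ι R) := invertibleNeg 1
  rw [det_fromBlocks₁₁, det_neg, det_one, mul_one, invOf_neg, invOf_one, Matrix.mul_neg,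
    Matrix.mul_one, Matrix.neg_mul, sub_neg_eq_add]

theorem det_cyclicBlock : (cyclicBlock S P Q).det =
    (-1) ^ (n * Fintype.card ι) * (P * (List.ofFn S).reverse.prod + Q).det := by
  induction n generalizing P with
  | zero =>
    have h : cyclicBlock S P Q = (P + Q).submatrix (Equiv.uniqueProd ι (Fin 1))
        (Equiv.uniqueProd ι (Fin 1)) := by
      ext ⟨h, i⟩ ⟨h', j⟩
      fin_cases h; fin_cases h'
      simp [cyclicBlock_zero]
    rw [h, det_submatrix_equiv_self]
    simp
  | succ n ih =>
    have schur_complement : cyclicBlock (Fin.init S) 0 Q +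
        (of fun x j => if x.1 = 0 then P x.2 j else 0) *
          (of fun i y => if y.1 = Fin.last n then S (Fin.last n) i y.2 else 0) =
        cyclicBlock (Fin.init S) (P * S (Fin.last n)) Q := by
      ext ⟨h, i⟩ ⟨h', j⟩
      refine Fin.cases ?_ (fun k => ?_) h
      · simp [cyclicBlock_zero, Matrix.mul_apply, add_comm]
      · simp [cyclicBlock_succ, Matrix.mul_apply]
    have prod_eq : (List.ofFn S).reverse.prod =
        S (Fin.last n) * (List.ofFn (Fin.init S)).reverse.prod := by
      rw [List.ofFn_succ_last, List.reverse_append, List.prod_append, List.reverse_singleton,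
        List.prod_singleton]
      rfl
    rw [← det_submatrix_equiv_self (lastBlockEquiv ι (n + 1)).symm,
      cyclicBlock_submatrix_lastBlockEquiv, det_fromBlocks_neg_one₁₁, schur_complement, ih,
      prod_eq, Matrix.mul_assoc]
    ring

theorem adjugate_cyclicBlock (i j : ι) : (cyclicBlock S P Q).adjugate (0, j) (0, i) =
    (-1) ^ (n * Fintype.card ι) * (P * (List.ofFn S).reverse.prod + Q).adjugate j i := by
  rw [adjugate_apply, cyclicBlock_updateRow, det_cyclicBlock, adjugate_apply]
  congr 2
  rw [updateRow_mul]
  ext a b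
  by_cases ha : a = i
  · subst ha
    simp
  · simp [ha]

end CyclicBlock

/-! ### The Burau representation -/

section Burau

variable {R : Type*} [CommRing R] (t : Rˣ)

/-- The transposed Burau matrices of `σ₁` and `σ₂`: with this transposition, the rows of the
Alexander matrix at a crossing are those of the transpose of `burauGen`, and braid words act from
left to right. -/
def burauGen : Fin 2 → GL (Fin 3) R
  | 0 =>
    { val := !![1 - (t : R), 1, 0; (t : R), 0, 0; 0, 0, 1]
      inv := !![0, ((t⁻¹ : Rˣ) : R), 0; 1, 1 - ((t⁻¹ : Rˣ) : R), 0; 0, 0, 1]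
      val_inv := by
        ext i j
        fin_cases i <;> fin_cases j <;> simp [sub_mul]
      inv_val := by
        ext i j
        fin_cases i <;> fin_cases j <;> simp [sub_mul] }
  | 1 =>
    { val := !![1, 0, 0; 0, 1 - (t : R), 1; 0, (t : R), 0]
      inv := !![1, 0, 0; 0, 0, ((t⁻¹ : Rˣ) : R); 0, 1, 1 - ((t⁻¹ : Rˣ) : R)]
      val_inv := by
        ext i j
        fin_cases i <;> fin_cases j <;> simp [sub_mul]
      inv_val := by
        ext i j
        fin_cases i <;> fin_cases j <;> simp [sub_mul] }

theorem burauGen_braid_relation : burauGen t 0 * burauGen t 1 * burauGen t 0 =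
    burauGen t 1 * burauGen t 0 * burauGen t 1 := by
  apply Units.ext
  ext i j
  fin_cases i <;> fin_cases j <;> simp [burauGen] <;> ring

/-- The unreduced Burau representation of `B₃` at `t`, transposed as in `burauGen`. -/
def burau : B₃ →* GL (Fin 3) R :=
  PresentedGroup.toGroup (f := burauGen t) <| by
    rintro _ rfl
    simp [burauGen_braid_relation t]

/-- The image of a letter of a braid word by the Burau representation. -/
def burauLetter (x : Fin 2 × Bool) : GL (Fin 3) R := cond x.2 (burauGen t x.1) (burauGen t x.1)⁻¹

theorem burau_toBraid (w : BraidWord) : burau t w.toBraid = (w.map (burauLetter t)).prod := by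
  rw [BraidWord.toBraid, burau]
  exact FreeGroup.lift_mk

theorem map_burau {R' : Type*} [CommRing R'] (f : R →+* R') (b : B₃) :
    GeneralLinearGroup.map f (burau t b) = burau (Units.map (f : R →* R') t) b := by
  suffices h : (GeneralLinearGroup.map f).comp (burau t) = burau (Units.map (f : R →* R') t) from
    DFunLike.congr_fun h b
  refine PresentedGroup.ext fun i => ?_
  rw [MonoidHom.comp_apply, burau, burau, PresentedGroup.toGroup.of, PresentedGroup.toGroup.of]
  apply Units.ext
  ext j k
  fin_cases i <;> fin_cases j <;> fin_cases k <;> simp [burauGen]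

theorem one_vecMul_burauLetter (x : Fin 2 × Bool) : 1 ᵥ* (burauLetter t x).val = 1 := by
  obtain ⟨i, c⟩ := x
  ext j
  fin_cases i <;> cases c <;> fin_cases j <;>
    simp [burauLetter, burauGen, vecMul, dotProduct, Fin.sum_univ_three]

theorem burauLetter_mulVec (x : Fin 2 × Bool) :
    (burauLetter t x).val *ᵥ ![1, (t : R), t ^ 2] = ![1, (t : R), t ^ 2] := by
  obtain ⟨i, c⟩ := x
  ext j
  fin_cases i <;> cases c <;> fin_cases j <;>
    simp [burauLetter, burauGen, mulVec, dotProduct, Fin.sum_univ_three, pow_two, sub_mul]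

theorem one_vecMul_burau_toBraid (w : BraidWord) : 1 ᵥ* (burau t w.toBraid).val = 1 := by
  rw [burau_toBraid]
  induction w with
  | nil => simp
  | cons x w ih =>
    rw [List.map_cons, List.prod_cons, Units.val_mul, ← vecMul_vecMul, one_vecMul_burauLetter, ih]

theorem burau_toBraid_mulVec (w : BraidWord) :
    (burau t w.toBraid).val *ᵥ ![1, (t : R), t ^ 2] = ![1, (t : R), t ^ 2] := by
  rw [burau_toBraid]
  induction w with
  | nil => simp
  | cons x w ih =>
    rw [List.map_cons, List.prod_cons, Units.val_mul, ← mulVec_mulVec, ih, burauLetter_mulVec]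

theorem adjugate_burau_sub_one (w : BraidWord) :
    ((burau t w.toBraid).val - 1).adjugate 0 0 * (1 + (t : R) + (t : R) ^ 2) =
      (burau t w.toBraid).val.det - (burau t w.toBraid).val.trace + 2 := by
  have column : ((burau t w.toBraid).val - 1) *ᵥ ![1, (t : R), t ^ 2] = 0 := by
    rw [sub_mulVec, burau_toBraid_mulVec, one_mulVec, sub_self]
  have row : 1 ᵥ* ((burau t w.toBraid).val - 1) = 0 := by
    rw [vecMul_sub, one_vecMul_burau_toBraid, vecMul_one, sub_self]
  have det_eq_zero : ((burau t w.toBraid).val - 1).det = 0 :=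
    det_eq_zero_of_mulVec_eq_zero_of_mem_nonZeroDivisors (i := 0) column (one_mem _)
  rw [← trace_adjugate_sub_one_add_det, det_eq_zero, add_zero,
    trace_adjugate_of_kernels (i := 0) (j := 0) column rfl row rfl]
  simp [dotProduct, Fin.sum_univ_three]

variable {t} in
theorem det_burau_eq_of_isConj {b b' : B₃} (h : IsConj b b') :
    (burau t b).val.det = (burau t b').val.det := by
  obtain ⟨c, hc⟩ := isConj_iff.mp ((burau t).map_isConj h)
  rw [← hc, Units.val_mul, Units.val_mul, det_units_conj]

variable {t} in
theorem trace_burau_eq_of_isConj {b b' : B₃} (h : IsConj b b') :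
    (burau t b).val.trace = (burau t b').val.trace := by
  obtain ⟨c, hc⟩ := isConj_iff.mp ((burau t).map_isConj h)
  rw [← hc, Units.val_mul, Units.val_mul, trace_units_conj]

/-- The Alexander matrix of the closure of a braid word, with the rows of the letter of height `k`
in the block of index `k + 1`, and those of the joints from the top to the bottom in the block of
index `0`. -/
def alexanderMatrix (w : BraidWord) :
    Matrix (Fin (w.length + 1) × Fin 3) (Fin (w.length + 1) × Fin 3) R :=
  cyclicBlock (fun k => (burauLetter t (w.get k)).valᵀ) 1 (-1)

theorem alexanderMatrix_mulVec_one (w : BraidWord) : alexanderMatrix t w *ᵥ 1 = 0 :=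
  cyclicBlock_one_neg_one_mulVec (v := 1) _ fun k => by
    rw [mulVec_transpose, one_vecMul_burauLetter]

theorem vecMul_alexanderMatrix (w : BraidWord) :
    (fun x => ![1, (t : R), t ^ 2] x.2) ᵥ* alexanderMatrix t w = 0 :=
  vecMul_cyclicBlock_one_neg_one (u := ![1, (t : R), t ^ 2]) _ fun k => by
    rw [vecMul_transpose, burauLetter_mulVec]

theorem associated_adjugate_alexanderMatrix (w : BraidWord) :
    Associated ((alexanderMatrix t w).adjugate (0, 0) (0, 0))
      (((burau t w.toBraid).val - 1).adjugate 0 0) := by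
  have transposed_prod : (List.ofFn fun k => (burauLetter t (w.get k)).valᵀ).reverse.prod =
      (burau t w.toBraid).valᵀ := by
    have letters : (List.ofFn fun k => (burauLetter t (w.get k)).valᵀ) =
        w.map fun x => (burauLetter t x).valᵀ :=
          List.ofFn_getElem_eq_map w fun x => (burauLetter t x).valᵀ
    rw [letters, burau_toBraid, ← Units.coeHom_apply, map_list_prod, transpose_list_prod,
      List.map_map, List.map_map]
    rfl
  rw [alexanderMatrix, adjugate_cyclicBlock, Matrix.one_mul, transposed_prod, ← sub_eq_add_neg,
    ← transpose_one, ← transpose_sub, ← adjugate_transpose, transpose_apply, transpose_one]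
  exact associated_unit_mul_left _ _ ((isUnit_neg_one).pow _)

end Burau

/-! ### The Alexander ideal of the closure of a braid -/

section AlexanderIdeal

/-- The variable `t` as a unit of `ℤ[t, t⁻¹]`. -/
def tUnit : (ℤ[T;T⁻¹])ˣ where
  val := T 1
  inv := T (-1)
  val_inv := by rw [← LaurentPolynomial.T_add]; rfl
  inv_val := by rw [← LaurentPolynomial.T_add]; rfl

theorem rows_braidLetterVertices {H : Type} [DecidableEq H] (a b : H) (x : Fin 2 × Bool) :
    ⋃ v ∈ braidLetterVertices a b x, v.rows = Set.range fun i : Fin 3 =>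
      (∑ j, (burauLetter tUnit x).val j i • Pi.single (a, j) 1) - Pi.single (b, i) 1 := by
  have range_eq : ∀ f : Fin 3 → H × Fin 3 → ℤ[T;T⁻¹], Set.range f = {f 0, f 1, f 2} := fun f => by
    ext y
    simp [Fin.exists_fin_succ, eq_comm]
  rw [range_eq]
  obtain ⟨i, c⟩ := x
  ext y
  fin_cases i <;> cases c <;>
    simp [braidLetterVertices, Vertex.rows, burauLetter, burauGen, tUnit, crossingVar,
      Fin.sum_univ_three, Fin.exists_fin_succ] <;>
    grind

theorem alexanderMatrix_row_zero (w : BraidWord) (i : Fin 3) :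
    (alexanderMatrix tUnit w).row (0, i) =
      Pi.single (Fin.last w.length, i) 1 - Pi.single (0, i) 1 := by
  ext ⟨h, j⟩ : 1
  simp [alexanderMatrix, cyclicBlock_zero, Pi.single_apply, one_apply, ite_and, eq_comm,
    sub_eq_add_neg, neg_ite]

theorem alexanderMatrix_row_succ (w : BraidWord) (k : Fin w.length) (i : Fin 3) :
    (alexanderMatrix tUnit w).row (k.succ, i) =
      (∑ j, (burauLetter tUnit (w.get k)).val j i • Pi.single (k.castSucc, j) 1) -
        Pi.single (k.succ, i) 1 := by
  ext ⟨h, j⟩ : 1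
  simp [alexanderMatrix, cyclicBlock_succ, Pi.single_apply, one_apply, ite_and, eq_comm]

theorem rows_closure (w : BraidWord) :
    (closure w).rows = Set.range (alexanderMatrix tUnit w).row := by
  have rows_eq : (closure w).rows =
      (⋃ k : Fin w.length, ⋃ v ∈ braidLetterVertices k.castSucc k.succ (w.get k), v.rows) ∪
        ⋃ i : Fin 3, (Vertex.joint (Fin.last w.length, i) (0, i)).rows :=
    (Set.biUnion_union _ _ _).trans (congrArg₂ _ (Set.biUnion_iUnion _ _) Set.biUnion_range)
  simp only [rows_eq, rows_braidLetterVertices, ← alexanderMatrix_row_succ]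
  simp only [Vertex.rows, ← alexanderMatrix_row_zero]
  ext y
  constructor
  · rintro (hy | hy)
    · obtain ⟨k, i, rfl⟩ := Set.mem_iUnion.mp hy
      exact ⟨(k.succ, i), rfl⟩
    · obtain ⟨i, rfl⟩ := Set.mem_iUnion.mp hy
      exact ⟨(0, i), rfl⟩
  · rintro ⟨⟨h, i⟩, rfl⟩
    refine Fin.cases (Or.inr ?_) (fun k => Or.inl ?_) h
    · exact Set.mem_iUnion.mpr ⟨i, rfl⟩
    · exact Set.mem_iUnion.mpr ⟨k, i, rfl⟩

theorem alexanderIdeal_closure (w : BraidWord) : (closure w).alexanderIdeal =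
    Ideal.span {((burau tUnit w.toBraid).val - 1).adjugate 0 0} := by
  calc (closure w).alexanderIdeal
      = Ideal.span (Set.range fun p : (closure w).Seg × (closure w).Seg =>
          (alexanderMatrix tUnit w).adjugate p.1 p.2) := by
        have : Nonempty (closure w).Seg := ⟨((0, 0) : Fin (w.length + 1) × Fin 3)⟩
        rw [Diagram.alexanderIdeal, rows_closure]
        exact span_minors_eq_span_adjugate _
    _ = Ideal.span {(alexanderMatrix tUnit w).adjugate (0, 0) (0, 0)} :=
        span_adjugate_eq_span_singleton (alexanderMatrix_mulVec_one tUnit w) rfl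
          (vecMul_alexanderMatrix tUnit w) rfl
    _ = _ := Ideal.span_singleton_eq_span_singleton.mpr
        (associated_adjugate_alexanderMatrix tUnit w)

theorem isAlexanderPolynomial_closure_iff (w : BraidWord) (P : ℤ[T;T⁻¹]) :
    (closure w).IsAlexanderPolynomial P ↔
      Associated P (((burau tUnit w.toBraid).val - 1).adjugate 0 0) := by
  simp only [Diagram.IsAlexanderPolynomial, alexanderIdeal_closure,
    Ideal.span_singleton_le_span_singleton]
  exact ⟨fun ⟨dvd, greatest⟩ => associated_of_dvd_dvd dvd (greatest _ dvd_rfl),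
    fun h => ⟨h.dvd, fun _ hQ => hQ.trans h.symm.dvd⟩⟩

end AlexanderIdeal

/-! ### The Burau representation on `SL₂(ℕ)` at `t = -q²` -/

section Deformation

theorem trace_eq_trace_add_one_of_intertwining {R : Type*} [CommRing R] {ι κ : Type*} [Fintype ι]
    [Fintype κ] [DecidableEq ι] [DecidableEq κ] {M : Matrix ι ι R} {D : Matrix κ κ R}
    {V : Matrix ι κ R} {W : Matrix κ ι R} {e f : ι → R} (hWV : W * V = 1)
    (hVW : V * W + vecMulVec e f = 1) (hMV : M * V = V * D) (hfM : f ᵥ* M = f)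
    (hfe : f ⬝ᵥ e = 1) : M.trace = D.trace + 1 := by
  calc M.trace = (M * (V * W + vecMulVec e f)).trace := by rw [hVW, Matrix.mul_one]
    _ = (V * (D * W)).trace + (f ᵥ* M) ⬝ᵥ e := by
      rw [Matrix.mul_add, trace_add, ← Matrix.mul_assoc, hMV, Matrix.mul_assoc, trace_mul_comm M,
        vecMulVec_mul, trace_vecMulVec, dotProduct_comm]
    _ = D.trace + 1 := by
      rw [trace_mul_comm, Matrix.mul_assoc, hWV, Matrix.mul_one, hfM, hfe]

section

variable {R : Type*} [CommRing R] (q : Rˣ)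

/-- A basis of the vectors with coordinates of sum `0`, in which the Burau representation at
`t = -q²` restricts to `q^{±1} A_q` on the letters. -/
def burauBasis : Matrix (Fin 3) (Fin 2) R := !![0, 1; -q, -1; q, 0]

theorem inv_burauGen_neg_sq_zero_mul_burauBasis :
    (burauGen (-q ^ 2) 0)⁻¹.val * burauBasis q =
      burauBasis q * (((q⁻¹ : Rˣ) : R) • !![(q : R), 0; 1, ((q⁻¹ : Rˣ) : R)]) := by
  have q_mul_inv : (q * (q⁻¹ : Rˣ) : R) = 1 := q.mul_inv
  ext i j
  fin_cases i <;> fin_cases j <;>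
    simp [burauGen, burauBasis, Matrix.mul_apply, Fin.sum_univ_three] <;> grind

theorem burauGen_neg_sq_one_mul_burauBasis :
    (burauGen (-q ^ 2) 1).val * burauBasis q =
      burauBasis q * ((q : R) • !![(q : R), 1; 0, ((q⁻¹ : Rˣ) : R)]) := by
  ext i j
  fin_cases i <;> fin_cases j <;>
    simp [burauGen, burauBasis, Matrix.mul_apply, Fin.sum_univ_three] <;> ring

variable {q}

theorem trace_eq_of_mul_burauBasis {M : Matrix (Fin 3) (Fin 3) R} {D : Matrix (Fin 2) (Fin 2) R}
    (mul_eq : M * burauBasis q = burauBasis q * D) (one_vecMul : 1 ᵥ* M = 1) :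
    M.trace = D.trace + 1 := by
  refine trace_eq_trace_add_one_of_intertwining
    (W := !![-((q⁻¹ : Rˣ) : R), -((q⁻¹ : Rˣ) : R), 0; 1, 0, 0]) (e := ![0, 0, 1]) (f := 1)
    ?_ ?_ mul_eq one_vecMul ?_
  · ext i j
    fin_cases i <;> fin_cases j <;> simp [burauBasis]
  · ext i j
    rw [Matrix.add_apply, vecMulVec_apply]
    fin_cases i <;> fin_cases j <;> simp [burauBasis]
  · simp [dotProduct, Fin.sum_univ_three]

end

theorem negSq_eq : negSq = -tUnit ^ 2 := by
  ext1
  rw [Units.val_neg, Units.val_pow_eq_pow_val]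
  exact congrArg Neg.neg (LaurentPolynomial.T_pow 1 2).symm

theorem burauLetter_negSq_mul_burauBasis (x : Letter) :
    (burauLetter negSq x.toBraidLetter).val * burauBasis tUnit =
      burauBasis tUnit * ((T x.sign : ℤ[T;T⁻¹]) • x.deformed) := by
  rw [negSq_eq]
  cases x
  · exact inv_burauGen_neg_sq_zero_mul_burauBasis tUnit
  · exact burauGen_neg_sq_one_mul_burauBasis tUnit

theorem burau_sigma (A : SL2N) :
    burau negSq (sigma A) = ((word A).map fun x => burauLetter negSq x.toBraidLetter).prod := by
  rw [sigma, burau_toBraid, sigmaWord, List.map_map]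
  rfl

theorem burau_sigma_mul_burauBasis (A : SL2N) :
    (burau negSq (sigma A)).val * burauBasis tUnit =
      burauBasis tUnit * ((T (Rad A) : ℤ[T;T⁻¹]) • deform A) := by
  rw [burau_sigma, Rad, deform]
  induction word A with
  | nil => simp
  | cons x v ih =>
    simp only [List.map_cons, List.prod_cons, List.sum_cons]
    rw [Units.val_mul, Matrix.mul_assoc, ih, ← Matrix.mul_assoc, burauLetter_negSq_mul_burauBasis,
      Matrix.mul_assoc, smul_mul_smul_comm, ← LaurentPolynomial.T_add]

theorem trace_burau_sigma (A : SL2N) :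
    (burau negSq (sigma A)).val.trace = T (Rad A) * (deform A).trace + 1 := by
  rw [← smul_eq_mul, ← trace_smul]
  exact trace_eq_of_mul_burauBasis (burau_sigma_mul_burauBasis A) (one_vecMul_burau_toBraid negSq _)

theorem det_burau_sigma (A : SL2N) : (burau negSq (sigma A)).val.det = T (2 * Rad A) := by
  have letter (x : Letter) :
      (burauLetter negSq x.toBraidLetter).val.det = T (2 * x.sign) := by
    cases x <;> simp [burauLetter, burauGen, negSq, Letter.toBraidLetter, Letter.sign,
      det_fin_three]
  rw [burau_sigma, Rad]
  induction word A with
  | nil => simp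
  | cons x v ih =>
    simp only [List.map_cons, List.prod_cons, List.sum_cons]
    rw [Units.val_mul, det_mul, ih, letter, mul_add, LaurentPolynomial.T_add]

theorem map_substNegSq_tUnit : Units.map (substNegSq : ℤ[T;T⁻¹] →* ℤ[T;T⁻¹]) tUnit = negSq := by
  ext1
  simp [substNegSq, tUnit]

theorem map_substNegSq_burau (b : B₃) :
    (burau tUnit b).val.map substNegSq = (burau negSq b).val := by
  rw [← map_substNegSq_tUnit, ← map_burau]
  rfl

theorem substNegSq_adjugate_burau_sub_one_mul {A : SL2N} {w : BraidWord}
    (hw : IsConj w.toBraid (sigma A)) :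
    substNegSq (((burau tUnit w.toBraid).val - 1).adjugate 0 0) * (1 - T 2 + T 4) =
      T (2 * Rad A) - T (Rad A) * (deform A).trace + 1 := by
  have h := adjugate_burau_sub_one negSq w
  rw [det_burau_eq_of_isConj hw, trace_burau_eq_of_isConj hw, det_burau_sigma,
    trace_burau_sigma] at h
  have adjugate_eq : substNegSq (((burau tUnit w.toBraid).val - 1).adjugate 0 0) =
      ((burau negSq w.toBraid).val - 1).adjugate 0 0 := by
    have map_adjugate := RingHom.map_adjugate substNegSq ((burau tUnit w.toBraid).val - 1)
    rw [map_sub, map_one, RingHom.mapMatrix_apply, RingHom.mapMatrix_apply,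
      map_substNegSq_burau] at map_adjugate
    exact congrFun₂ map_adjugate 0 0
  have val_negSq : (negSq : ℤ[T;T⁻¹]) = -T 2 := rfl
  have q_pow_four : (T 4 : ℤ[T;T⁻¹]) = T 2 * T 2 := LaurentPolynomial.T_add 2 2
  rw [adjugate_eq]
  rw [val_negSq] at h
  linear_combination h + ((burau negSq w.toBraid).val - 1).adjugate 0 0 * q_pow_four

theorem associated_substNegSq_of_isAlexanderPolynomial {A : SL2N} {w : BraidWord}
    (hw : IsConj w.toBraid (sigma A)) {P : ℤ[T;T⁻¹]}
    (hP : (closure w).IsAlexanderPolynomial P) :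
    Associated (substNegSq P * (T 2 - 1 + T (-2)))
      (T (Rad A) - (deform A).trace + T (-Rad A)) := by
  rw [isAlexanderPolynomial_closure_iff] at hP
  have isUnit_q_pow (n : ℤ) : IsUnit (T n : ℤ[T;T⁻¹]) := LaurentPolynomial.isUnit_T n
  refine ((hP.map substNegSq).mul_right _).trans
    ((associated_mul_unit_right _ _ (isUnit_q_pow 2)).trans
      (.trans (.of_eq ?_) (associated_mul_unit_right _ _ (isUnit_q_pow (Rad A))).symm))
  have q_mul (m n : ℤ) : (T m * T n : ℤ[T;T⁻¹]) = T (m + n) := (LaurentPolynomial.T_add m n).symm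
  have q_mul_inv (n : ℤ) : (T n * T (-n) : ℤ[T;T⁻¹]) = 1 := by rw [q_mul, add_neg_cancel]; rfl
  have q_pow_four : (T 2 * T 2 : ℤ[T;T⁻¹]) = T 4 := q_mul 2 2
  have q_pow_two_mul : (T (Rad A) * T (Rad A) : ℤ[T;T⁻¹]) = T (2 * Rad A) := by
    rw [q_mul, two_mul]
  linear_combination substNegSq_adjugate_burau_sub_one_mul hw +
    substNegSq (((burau tUnit w.toBraid).val - 1).adjugate 0 0) * (q_mul_inv 2 + q_pow_four) -
    q_mul_inv (Rad A) - q_pow_two_mul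

end Deformation

/-! ### Paths in `SL₂(ℝ)` -/

section Entries

variable {R : Type*} [CommRing R]

theorem sl2_det_eq_one (g : SL(2, R)) : g 0 0 * g 1 1 - g 0 1 * g 1 0 = 1 := by
  rw [← det_fin_two, g.det_coe]

theorem sl2_mul_apply (g h : SL(2, R)) (i j : Fin 2) :
    (g * h : SL(2, R)) i j = g i 0 * h 0 j + g i 1 * h 1 j := by
  rw [Matrix.SpecialLinearGroup.coe_mul, mul_apply, Fin.sum_univ_two]

end Entries

section PosCorner

/-- The matrices of `SL₂(ℝ)` whose first entry is positive. They contain the matrices with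
non-negative entries, and are contractible because the other three entries determine the last. -/
def posCorner : Set SL(2, ℝ) := {g | 0 < g 0 0}

theorem mem_posCorner {g : SL(2, ℝ)} : g ∈ posCorner ↔ 0 < g 0 0 := Iff.rfl

theorem mem_posCorner_of_nonneg {g : SL(2, ℝ)} (hg : ∀ i j, 0 ≤ g i j) : g ∈ posCorner := by
  refine (hg 0 0).lt_of_ne' fun corner_eq => ?_
  have det_eq := sl2_det_eq_one g
  rw [corner_eq] at det_eq
  linarith [mul_nonneg (hg 0 1) (hg 1 0)]

/-- The first three entries as coordinates on `posCorner`. -/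
def posCornerHomeomorph : posCorner ≃ₜ Set.Ioi (0 : ℝ) × ℝ × ℝ where
  toFun g := (⟨g.1 0 0, g.2⟩, g.1 0 1, g.1 1 0)
  invFun x := ⟨⟨!![x.1.1, x.2.1; x.2.2, (1 + x.2.1 * x.2.2) / x.1.1], by
    rw [det_fin_two_of, mul_div_cancel₀ _ x.1.2.ne']
    ring⟩, x.1.2⟩
  left_inv g := by
    have lower_right : (1 + g.1 0 1 * g.1 1 0) / g.1 0 0 = g.1 1 1 := by
      rw [div_eq_iff (ne_of_gt g.2)]
      linarith [sl2_det_eq_one g.1]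
    ext i j
    fin_cases i <;> fin_cases j <;> simp [lower_right]
  right_inv _ := rfl
  continuous_toFun := by fun_prop
  continuous_invFun := by
    refine Continuous.subtype_mk (Continuous.subtype_mk (continuous_matrix fun i j => ?_) _) _
    fin_cases i <;> fin_cases j <;>
      simp only [Fin.zero_eta, Fin.mk_one, of_apply, cons_val', cons_val_zero, cons_val_one,
        cons_val_fin_one] <;>
      fun_prop (disch := exact fun x => x.1.2.ne')

instance : ContractibleSpace posCorner :=
  haveI : ContractibleSpace (Set.Ioi (0 : ℝ)) :=
    (convex_Ioi 0).contractibleSpace Set.nonempty_Ioi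
  posCornerHomeomorph.contractibleSpace

theorem homotopic_of_forall_mem {X : Type*} [TopologicalSpace X] {S : Set X}
    [SimplyConnectedSpace S] {x y : X} {p q : Path x y} (hp : ∀ s, p s ∈ S) (hq : ∀ s, q s ∈ S) :
    p.Homotopic q := by
  have hx : x ∈ S := p.source ▸ hp 0
  have hy : y ∈ S := p.target ▸ hp 1
  let restrict (r : Path x y) (hr : ∀ s, r s ∈ S) : Path (⟨x, hx⟩ : S) ⟨y, hy⟩ :=
    { toFun := fun s => ⟨r s, hr s⟩
      source' := Subtype.ext r.source
      target' := Subtype.ext r.target }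
  exact (SimplyConnectedSpace.paths_homotopic (restrict p hp) (restrict q hq)).map
    ⟨Subtype.val, continuous_subtype_val⟩

end PosCorner

section Joined

theorem Letter.unipotent_zero (x : Letter) : x.unipotent 0 = 1 := by
  ext i j
  cases x <;> fin_cases i <;> fin_cases j <;> simp [Letter.unipotent]

theorem Letter.joined_one_unipotent (x : Letter) (s : ℝ) : Joined 1 (x.unipotent s) := by
  rw [← x.unipotent_zero]
  exact (PathConnectedSpace.joined 0 s).map x.continuous_unipotent

theorem eq_unipotent_mul_unipotent_mul_unipotent {g : SL(2, ℝ)} (hg : g 1 0 ≠ 0) :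
    g = Letter.R.unipotent ((g 0 0 - 1) / g 1 0) * Letter.L.unipotent (g 1 0) *
      Letter.R.unipotent ((g 1 1 - 1) / g 1 0) := by
  have det_eq := sl2_det_eq_one g
  ext i j
  simp only [sl2_mul_apply]
  fin_cases i <;> fin_cases j <;>
    simp only [Fin.zero_eta, Fin.mk_one, Letter.unipotent, of_apply, cons_val', cons_val_zero,
      cons_val_fin_one, cons_val_one, mul_one, one_mul, mul_zero, zero_add, add_zero] <;>
    field_simp <;> linarith

theorem joined_one (g : SL(2, ℝ)) : Joined 1 g := by
  have joined_of_ne_zero {h : SL(2, ℝ)} (hh : h 1 0 ≠ 0) : Joined 1 h := by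
    rw [eq_unipotent_mul_unipotent_mul_unipotent hh]
    simpa only [mul_one] using ((Letter.R.joined_one_unipotent _).mul
      (Letter.L.joined_one_unipotent _)).mul (Letter.R.joined_one_unipotent _)
  by_cases hg : g 1 0 = 0
  · have corner_ne_zero : (g * Letter.L.unipotent 1) 1 0 ≠ 0 := by
      have det_eq := sl2_det_eq_one g
      rw [hg, mul_zero, sub_zero] at det_eq
      rw [sl2_mul_apply, hg]
      simpa [Letter.unipotent] using right_ne_zero_of_mul_eq_one det_eq
    simpa only [mul_inv_cancel_right, inv_one, mul_one] using
      (joined_of_ne_zero corner_ne_zero).mul (Letter.L.joined_one_unipotent 1).inv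
  · exact joined_of_ne_zero hg

end Joined

/-! ### Homotopies of loops in the unit tangent bundle -/

/-- The inclusion of `SL₂(ℤ)` in `SL₂(ℝ)`. -/
abbrev toReal : SL(2, ℤ) →* SL(2, ℝ) :=
  Matrix.SpecialLinearGroup.map (Int.castRingHom ℝ)

theorem freelyHomotopic_of_lift {A : SL(2, ℤ)} {p q : Path 1 (toReal A)} (hpq : p.Homotopic q)
    (g : SL(2, ℝ)) {γ₀ γ₁ : C(I, UnitTangent)} (h₀ : ∀ s, γ₀ s = proj (p s))
    (h₁ : ∀ s, γ₁ s = proj (q s * g)) : FreelyHomotopic γ₀ γ₁ := by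
  obtain ⟨F⟩ := hpq
  obtain ⟨δ⟩ := joined_one g
  exact ⟨{
    toFun x := proj (F x * δ x.1)
    continuous_toFun := continuous_proj.comp (by fun_prop)
    map_zero_left s := by simp [h₀]
    map_one_left s := by simp [h₁]
    prop' t := by
      change proj (F (t, 0) * δ t) = proj (F (t, 1) * δ t)
      rw [F.source, F.target, proj_mul, one_mul] }⟩

section BraidLift

theorem sl2_mul_nonneg {R : Type*} [CommRing R] [PartialOrder R] [IsOrderedRing R]
    {g h : SL(2, R)} (hg : ∀ i j, 0 ≤ g i j) (hh : ∀ i j, 0 ≤ h i j) (i j : Fin 2) :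
    0 ≤ (g * h : SL(2, R)) i j := by
  rw [sl2_mul_apply]
  exact add_nonneg (mul_nonneg (hg i 0) (hh 0 j)) (mul_nonneg (hg i 1) (hh 1 j))

theorem Letter.unipotent_one (x : Letter) : x.unipotent 1 = toReal x.toSL := by
  ext i j
  rw [Matrix.SpecialLinearGroup.map_apply_coe]
  cases x <;> fin_cases i <;> fin_cases j <;> simp [Letter.unipotent, Letter.toSL]

theorem Letter.unipotent_nonneg (x : Letter) {s : ℝ} (hs : 0 ≤ s) (i j : Fin 2) :
    0 ≤ x.unipotent s i j := by
  cases x <;> fin_cases i <;> fin_cases j <;> simp [Letter.unipotent, hs]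

/-- The path `s ↦ x^s` of unipotent matrices, which lifts the loop of the letter `x`. -/
def Letter.path (x : Letter) : Path 1 (toReal x.toSL) where
  toFun s := x.unipotent s
  continuous_toFun := x.continuous_unipotent.comp continuous_subtype_val
  source' := x.unipotent_zero
  target' := x.unipotent_one

theorem exists_lift_braidLoop (v : List Letter) :
    ∃ p : Path 1 (toReal (wordProd v)), (∀ s i j, 0 ≤ p s i j) ∧
      ∀ s, braidLoop (v.map Letter.toBraidLetter) s = proj (p s) := by
  induction v with
  | nil =>
    have endpoint : toReal (wordProd []) = 1 := map_one toReal
    refine ⟨(Path.refl 1).cast rfl endpoint, fun s i j => ?_, fun _ => rfl⟩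
    rw [Path.cast_coe, Path.refl_apply]
    fin_cases i <;> fin_cases j <;> simp
  | cons x v ih =>
    obtain ⟨p, p_nonneg, proj_p⟩ := ih
    let translate : Path (toReal x.toSL) (toReal x.toSL * toReal (wordProd v)) :=
      (p.map (continuous_const_mul (toReal x.toSL))).cast (mul_one _).symm rfl
    have endpoint : toReal (wordProd (x :: v)) = toReal x.toSL * toReal (wordProd v) := by
      rw [wordProd_cons, map_mul]
    have path_nonneg (s : I) (i j : Fin 2) : 0 ≤ x.path s i j := x.unipotent_nonneg s.2.1 i j
    refine ⟨(x.path.trans translate).cast rfl endpoint, fun s i j => ?_, fun s => ?_⟩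
    · rw [Path.cast_coe, Path.trans_apply]
      split_ifs with first_half
      · exact path_nonneg _ i j
      · exact sl2_mul_nonneg (x.path.target ▸ path_nonneg 1) (p_nonneg _) i j
    · have genLoop_eq : genLoop x.toBraidLetter = x.loop := by cases x <;> rfl
      rw [List.map_cons, braidLoop, Path.cast_coe, Path.trans_apply, Path.trans_apply, genLoop_eq]
      split_ifs
      · rfl
      · exact (proj_p _).trans (proj_mul x.toSL _).symm

end BraidLift

section Flow

theorem continuous_flow : Continuous flow := by
  refine Continuous.subtype_mk (continuous_matrix fun i j => ?_) _
  fin_cases i <;> fin_cases j <;>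
    simp only [Fin.zero_eta, Fin.mk_one, of_apply, cons_val', cons_val_zero, cons_val_one,
      cons_val_fin_one] <;>
    fun_prop

theorem flow_zero : flow 0 = 1 := by
  ext i j
  fin_cases i <;> fin_cases j <;> simp [flow]

theorem conj_flow_apply_zero_zero (g : SL(2, ℝ)) (s : ℝ) :
    (g * flow s * g⁻¹ : SL(2, ℝ)) 0 0 =
      Real.exp (-s) * (1 + g 0 0 * g 1 1 * (Real.exp (2 * s) - 1)) := by
  have exp_two_mul : Real.exp (2 * s) = Real.exp s ^ 2 := by rw [← Real.exp_nat_mul, Nat.cast_two]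
  have exp_neg_mul : Real.exp (-s) * Real.exp s = 1 := by rw [← Real.exp_add]; simp
  rw [sl2_mul_apply, sl2_mul_apply, sl2_mul_apply, Matrix.SpecialLinearGroup.SL2_inv_expl]
  simp only [flow, of_apply, cons_val', cons_val_zero, cons_val_fin_one, cons_val_one, mul_zero,
    add_zero, zero_add, mul_neg]
  linear_combination Real.exp (-s) * sl2_det_eq_one g -
    g 0 0 * g 1 1 * Real.exp s * exp_neg_mul - g 0 0 * g 1 1 * Real.exp (-s) * exp_two_mul

/-- Up to a positive factor the first entry along the orbit is affine in `exp (2 * s)`, so it is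
positive between two points where it is positive. -/
theorem conj_flow_mem_posCorner {g : SL(2, ℝ)} {s l : ℝ} (hs : 0 ≤ s) (hsl : s ≤ l)
    (hl : g * flow l * g⁻¹ ∈ posCorner) : g * flow s * g⁻¹ ∈ posCorner := by
  simp only [mem_posCorner, conj_flow_apply_zero_zero,
    mul_pos_iff_of_pos_left (Real.exp_pos _)] at hl ⊢
  have one_le : 1 ≤ Real.exp (2 * s) := Real.one_le_exp (by positivity)
  have exp_le : Real.exp (2 * s) ≤ Real.exp (2 * l) := by gcongr
  rcases le_or_gt 0 (g 0 0 * g 1 1) with coeff_nonneg | coeff_neg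
  · linarith [mul_nonneg coeff_nonneg (sub_nonneg.mpr one_le)]
  · linarith [mul_nonneg_of_nonpos_of_nonpos coeff_neg.le (sub_nonpos.mpr exp_le)]

end Flow

/-! ### Modular knots -/

theorem freelyHomotopic_braidLoop_of_isModularKnot (A : SL2N) {γ : C(I, UnitTangent)}
    (hγ : IsModularKnot A γ) :
    FreelyHomotopic (braidLoop (sigmaWord A)).toContinuousMap γ := by
  obtain ⟨g, l, l_pos, mul_eq, γ_eq⟩ := hγ
  have word_eq : wordProd (word A) = A := (existsUnique_word A).choose_spec.1
  have exists_lift := exists_lift_braidLoop (word A)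
  rw [word_eq] at exists_lift
  obtain ⟨p, p_nonneg, proj_p⟩ := exists_lift
  let q : Path 1 (toReal A) :=
    { toFun s := g * flow (s * l) * g⁻¹
      continuous_toFun := (continuous_const.mul (continuous_flow.comp (by fun_prop))).mul
        continuous_const
      source' := by simp [flow_zero]
      target' := by simp [← mul_eq] }
  have p_mem (s : I) : p s ∈ posCorner := mem_posCorner_of_nonneg (p_nonneg s)
  have endpoint_mem : g * flow l * g⁻¹ ∈ posCorner := by
    rw [← mul_eq, mul_inv_cancel_right]
    exact p.target ▸ p_mem 1
  have q_mem (s : I) : q s ∈ posCorner :=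
    conj_flow_mem_posCorner (mul_nonneg s.2.1 l_pos.le) (mul_le_of_le_one_left l_pos.le s.2.2)
      endpoint_mem
  refine freelyHomotopic_of_lift (homotopic_of_forall_mem p_mem q_mem) g proj_p fun s => ?_
  rw [γ_eq]
  exact congrArg proj (inv_mul_cancel_right _ g).symm

section Diagonalization

theorem exists_isUnit_mul_eq_mul_diagonal {K n : Type*} [Field K] [Fintype n] [DecidableEq n]
    {A : Matrix n n K} {μ : n → K} (hμ : Function.Injective μ)
    (hA : ∀ i, A.charpoly.IsRoot (μ i)) :
    ∃ P : Matrix n n K, IsUnit P ∧ A * P = P * diagonal μ := by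
  have exists_eigenvector (i : n) : ∃ v, Module.End.HasEigenvector (toLin' A) (μ i) v := by
    refine ((Module.End.hasEigenvalue_iff_isRoot_charpoly _ _).mpr ?_).exists_hasEigenvector
    rw [charpoly_toLin']
    exact hA i
  choose v hv using exists_eigenvector
  refine ⟨of fun i j => v j i, linearIndependent_cols_iff_isUnit.mp
    (Module.End.eigenvectors_linearIndependent' _ μ hμ v hv), ?_⟩
  ext i j
  rw [mul_diagonal, mul_comm]
  exact congrFun (hv j).apply_eq_smul i

theorem isRoot_charpoly_of_trace_eq {A : SL(2, ℝ)} {s : ℝ}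
    (hs : A.val.trace = 2 * Real.cosh s) : A.val.charpoly.IsRoot (Real.exp s) := by
  have exp_mul_neg : Real.exp s * Real.exp (-s) = 1 := by rw [← Real.exp_add]; simp
  rw [charpoly_fin_two, A.det_coe, hs, Real.cosh_eq]
  simp only [Polynomial.IsRoot, Polynomial.eval_add, Polynomial.eval_sub, Polynomial.eval_pow,
    Polynomial.eval_X, Polynomial.eval_mul, Polynomial.eval_C]
  linear_combination -exp_mul_neg

theorem exists_mul_eq_mul_flow {A : SL(2, ℝ)} {l : ℝ} (hl : l ≠ 0)
    (hA : A.val.trace = 2 * Real.cosh l) : ∃ g : SL(2, ℝ), A * g = g * flow l := by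
  obtain ⟨P, isUnit_P, mul_eq⟩ :=
    exists_isUnit_mul_eq_mul_diagonal (A := A.val) (μ := ![Real.exp l, Real.exp (-l)])
      (List.nodup_ofFn.mp (by simpa using self_ne_neg.mpr hl))
      (Fin.forall_fin_two.mpr ⟨isRoot_charpoly_of_trace_eq hA,
        isRoot_charpoly_of_trace_eq (by rwa [Real.cosh_neg])⟩)
  have det_ne_zero : P.det ≠ 0 := ((isUnit_iff_isUnit_det P).mp isUnit_P).ne_zero
  refine ⟨⟨P * diagonal ![P.det⁻¹, 1], by
    rw [det_mul, det_diagonal, Fin.prod_univ_two]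
    simp [det_ne_zero]⟩, Subtype.ext ?_⟩
  have flow_eq : (flow l).val = diagonal ![Real.exp l, Real.exp (-l)] := by
    ext i j
    fin_cases i <;> fin_cases j <;> simp [flow]
  change A.val * (P * diagonal _) = P * diagonal _ * (flow l).val
  rw [flow_eq, ← mul_assoc, mul_eq, mul_assoc, mul_assoc, (commute_diagonal _ _).eq]

end Diagonalization

theorem two_lt_trace_of_isHyperbolic {A : SL2N} (hA : (A : SL(2, ℤ)).val.IsHyperbolic) :
    2 < A.val.val.trace := by
  have trace_nonneg : 0 ≤ A.val.val.trace := by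
    rw [trace_fin_two]
    exact add_nonneg (A.2 0 0) (A.2 1 1)
  rw [IsHyperbolic, discr_fin_two, Matrix.SpecialLinearGroup.det_coe] at hA
  nlinarith

theorem exists_isModularKnot {A : SL2N} (hA : (A : SL(2, ℤ)).val.IsHyperbolic) :
    ∃ γ, IsModularKnot A γ := by
  have trace_gt : 1 < (toReal A).val.trace / 2 := by
    have trace_eq : (toReal A).val.trace = (A.val.val.trace : ℝ) := by
      simp [trace_fin_two]
    rw [trace_eq, lt_div_iff₀ two_pos, one_mul]
    exact_mod_cast two_lt_trace_of_isHyperbolic hA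
  obtain ⟨g, mul_eq⟩ := exists_mul_eq_mul_flow (Real.arcosh_pos trace_gt).ne'
    (A := toReal A) (by rw [Real.cosh_arcosh trace_gt.le, mul_div_cancel₀ _ two_ne_zero])
  exact ⟨⟨fun s => proj (g * flow (s * Real.arcosh _)), continuous_proj.comp
    (continuous_const.mul (continuous_flow.comp (by fun_prop)))⟩, g, _,
    Real.arcosh_pos trace_gt, mul_eq, fun _ => rfl⟩

end ModularBraid

end

theorem mainTheorem10_general (A : ModularBraid.SL2N) :
    ((A : SL(2, ℤ)).val.IsHyperbolic → ∃ γ, ModularBraid.IsModularKnot A γ) ∧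
    (∀ γ, ModularBraid.IsModularKnot A γ →
      ModularBraid.FreelyHomotopic
        (ModularBraid.braidLoop (ModularBraid.sigmaWord A)).toContinuousMap γ) ∧
    ∀ w : ModularBraid.BraidWord, IsConj w.toBraid (ModularBraid.sigma A) →
      (∃ P, (ModularBraid.closure w).IsAlexanderPolynomial P) ∧
      ∀ P, (ModularBraid.closure w).IsAlexanderPolynomial P →
        Associated
          (ModularBraid.substNegSq P *
            (LaurentPolynomial.T 2 - 1 + LaurentPolynomial.T (-2)))
          (LaurentPolynomial.T (ModularBraid.Rad A) - (ModularBraid.deform A).trace +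
            LaurentPolynomial.T (-ModularBraid.Rad A)) := by
  refine ⟨ModularBraid.exists_isModularKnot,
    fun _ => ModularBraid.freelyHomotopic_braidLoop_of_isModularKnot A, fun w hw => ⟨?_, ?_⟩⟩
  · exact ⟨_, (ModularBraid.isAlexanderPolynomial_closure_iff w _).mpr (.refl _)⟩
  · exact fun _ => ModularBraid.associated_substNegSq_of_isAlexanderPolynomial hw

theorem mainTheorem10 (A : ModularBraid.SL2N)
    (hhyp : (A : SL(2, ℤ)).val.IsHyperbolic)
    (hprim : ModularBraid.IsPrimitiveElement
      (QuotientGroup.mk (A : SL(2, ℤ)) : Matrix.ProjectiveSpecialLinearGroup (Fin 2) ℤ)) :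
    ((∃ γ, ModularBraid.IsModularKnot A γ) ∧
      ∀ γ, ModularBraid.IsModularKnot A γ →
        ModularBraid.FreelyHomotopic
          (ModularBraid.braidLoop (ModularBraid.sigmaWord A)).toContinuousMap γ) ∧
    ∀ w : ModularBraid.BraidWord, IsConj w.toBraid (ModularBraid.sigma A) →
      (∃ P, (ModularBraid.closure w).IsAlexanderPolynomial P) ∧
      ∀ P, (ModularBraid.closure w).IsAlexanderPolynomial P →
        Associated
          (ModularBraid.substNegSq P *
            (LaurentPolynomial.T 2 - 1 + LaurentPolynomial.T (-2)))
          (LaurentPolynomial.T (ModularBraid.Rad A) - (ModularBraid.deform A).trace +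
            LaurentPolynomial.T (-ModularBraid.Rad A)) := by
  obtain ⟨exists_knot, homotopic, alexander⟩ := mainTheorem10_general A
  exact ⟨⟨exists_knot hhyp, homotopic⟩, alexander⟩
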